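/- Let $X$ and $Y$ be Banach spaces (both real or both complex) with unconditional Schauder decompositions $\{X_i\}_{i\in I}$ and $\{Y_j\}_{j\in J}$, respectively, where $I$ and $J$ are arbitrary index sets and all $X_i$ and $Y_j$ are finite-dimensional; that is, the $X_i$ are closed linear subspaces of $X$ and each $x\in X$ can be written in a unique way as an unconditionally convergent series $x=\sum_{i\in I}x_i$ with $x_i\in X_i$ for all $i\in I$, and similarly for $Y$. For a finite set $C\subset I$ and $x=\sum_{i\in I}x_i$ as above put $P_C(x)=\sum_{i\in C}x_i$, and define $Q_D(y)$ for finite $D\subset J$ and $y\in Y$ likewise. Let $1<p,q<\infty$ satisfy $1/p+1/q\geq 1$, and suppose that $\{X_i\}_{i\in I}$ has a disjoint lower $p$-estimate, i.e. there is a constant $c>0$ such that $$\Big(\sum_{k=1}^r\|P_{C_k}(x)\|^p\Big)^{1/p}\leq c\,\|x\|$$ for every finite collection $C_1,\dots,C_r$ of pairwise disjoint finite subsets of $I$ and every $x\in X$, and that $\{Y_j\}_{j\in J}$ has a disjoint lower $q$-estimate, i.e. the same holds with $Y$, $J$, $Q_D$, $q$ in place of $X$, $I$, $P_C$, $p$.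 Let $U\subset X$ and $V\subset Y$ be infinite-dimensional closed linear subspaces. Then the projective tensor product $U\widehat{\otimes}_\pi V$, i.e. the completion of the algebraic tensor product $U\otimes V$ with respect to the norm $\|z\|=\sup\{|S(z)|: S \text{ a continuous bilinear functional on } U\times V,\ \|S\|\leq 1\}$, contains a closed subspace isomorphic to $\ell_1$. -/

import Mathlib

open scoped TensorProduct ENNReal

namespace PTen

section Tensor

/-- The algebraic tensor product `X ⊗ Y`, as a type of its own, to be equipped with the
projective norm. -/
def AlgTensor (𝕜 X Y : Type*) [RCLike 𝕜] [NormedAddCommGroup X] [NormedSpace 𝕜 X]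
    [NormedAddCommGroup Y] [NormedSpace 𝕜 Y] : Type _ := X ⊗[𝕜] Y

variable {𝕜 X Y : Type*} [RCLike 𝕜] [NormedAddCommGroup X] [NormedSpace 𝕜 X]
  [NormedAddCommGroup Y] [NormedSpace 𝕜 Y]

noncomputable instance : AddCommGroup (AlgTensor 𝕜 X Y) :=
  inferInstanceAs (AddCommGroup (X ⊗[𝕜] Y))

noncomputable instance : Module 𝕜 (AlgTensor 𝕜 X Y) :=
  inferInstanceAs (Module 𝕜 (X ⊗[𝕜] Y))

/-- The elementary tensor `x ⊗ y`. -/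
def AlgTensor.tmul (𝕜 : Type*) {X Y : Type*} [RCLike 𝕜] [NormedAddCommGroup X]
    [NormedSpace 𝕜 X] [NormedAddCommGroup Y] [NormedSpace 𝕜 Y] (x : X) (y : Y) :
    AlgTensor 𝕜 X Y := x ⊗ₜ[𝕜] y

/-- The linear functional on `X ⊗ Y` induced by a continuous bilinear functional `S` on `X × Y`,
that is, the one with `x ⊗ y ↦ S x y`. -/
noncomputable def AlgTensor.functional (S : X →L[𝕜] Y →L[𝕜] 𝕜) : AlgTensor 𝕜 X Y →ₗ[𝕜] 𝕜 :=
  TensorProduct.lift (ContinuousLinearMap.toLinearMap₁₂ S)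

theorem AlgTensor.functional_tmul (S : X →L[𝕜] Y →L[𝕜] 𝕜) (x : X) (y : Y) :
    AlgTensor.functional S (AlgTensor.tmul 𝕜 x y) = S x y :=
  TensorProduct.lift.tmul x y

/-- The projective norm `‖z‖ = sup {|S z| : S a continuous bilinear functional, ‖S‖ ≤ 1}`. -/
noncomputable instance : Norm (AlgTensor 𝕜 X Y) where
  norm z := ⨆ S : {S : X →L[𝕜] Y →L[𝕜] 𝕜 // ‖S‖ ≤ 1}, ‖AlgTensor.functional S.1 z‖

theorem AlgTensor.norm_def (z : AlgTensor 𝕜 X Y) :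
    ‖z‖ = ⨆ S : {S : X →L[𝕜] Y →L[𝕜] 𝕜 // ‖S‖ ≤ 1}, ‖AlgTensor.functional S.1 z‖ := rfl

/-- The supremum that defines the projective norm is finite. -/
theorem AlgTensor.bddAbove (z : AlgTensor 𝕜 X Y) : BddAbove (Set.range
    fun S : {S : X →L[𝕜] Y →L[𝕜] 𝕜 // ‖S‖ ≤ 1} => ‖AlgTensor.functional S.1 z‖) := by
  suffices h : ∃ M : ℝ, ∀ S : X →L[𝕜] Y →L[𝕜] 𝕜, ‖S‖ ≤ 1 →
      ‖AlgTensor.functional S z‖ ≤ M by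
    obtain ⟨M, hM⟩ := h
    exact ⟨M, by rintro _ ⟨S, rfl⟩; exact hM S.1 S.2⟩
  refine TensorProduct.induction_on (motive := fun z : X ⊗[𝕜] Y =>
    ∃ M : ℝ, ∀ S : X →L[𝕜] Y →L[𝕜] 𝕜, ‖S‖ ≤ 1 →
      ‖(AlgTensor.functional S : AlgTensor 𝕜 X Y →ₗ[𝕜] 𝕜) z‖ ≤ M) z ?_ ?_ ?_
  · exact ⟨0, fun S _ => le_of_eq (by
      rw [show (AlgTensor.functional S : AlgTensor 𝕜 X Y →ₗ[𝕜] 𝕜) (0 : X ⊗[𝕜] Y) = 0 from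
        map_zero (AlgTensor.functional S), norm_zero])⟩
  · intro x y
    refine ⟨‖x‖ * ‖y‖, fun S hS => ?_⟩
    have h := AlgTensor.functional_tmul S x y
    have h2 : ‖S x y‖ ≤ ‖x‖ * ‖y‖ := by
      refine (S.le_opNorm₂ x y).trans ?_
      have := mul_le_mul_of_nonneg_right hS (mul_nonneg (norm_nonneg x) (norm_nonneg y))
      linarith
    rw [← h] at h2
    exact h2
  · rintro a b ⟨A, hA⟩ ⟨B, hB⟩
    refine ⟨A + B, fun S hS => ?_⟩
    rw [show (AlgTensor.functional S : AlgTensor 𝕜 X Y →ₗ[𝕜] 𝕜) (a + b : X ⊗[𝕜] Y) = _ from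
      map_add (AlgTensor.functional S) a b]
    exact (norm_add_le _ _).trans (add_le_add (hA S hS) (hB S hS))

theorem AlgTensor.le_norm (S : X →L[𝕜] Y →L[𝕜] 𝕜) (hS : ‖S‖ ≤ 1) (z : AlgTensor 𝕜 X Y) :
    ‖AlgTensor.functional S z‖ ≤ ‖z‖ :=
  le_ciSup (AlgTensor.bddAbove z) ⟨S, hS⟩

theorem AlgTensor.norm_le {z : AlgTensor 𝕜 X Y} {M : ℝ}
    (h : ∀ S : X →L[𝕜] Y →L[𝕜] 𝕜, ‖S‖ ≤ 1 → ‖AlgTensor.functional S z‖ ≤ M) : ‖z‖ ≤ M := by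
  have : Nonempty {S : X →L[𝕜] Y →L[𝕜] 𝕜 // ‖S‖ ≤ 1} := ⟨⟨0, (norm_zero (E := X →L[𝕜] Y →L[𝕜] 𝕜)).trans_le zero_le_one⟩⟩
  exact ciSup_le fun S => h S.1 S.2

theorem AlgTensor.core : SeminormedSpace.Core 𝕜 (AlgTensor 𝕜 X Y) where
  norm_nonneg z := Real.iSup_nonneg fun _ => norm_nonneg _
  norm_smul c z := by
    rw [AlgTensor.norm_def, AlgTensor.norm_def, Real.mul_iSup_of_nonneg (norm_nonneg c)]
    simp only [map_smul, norm_smul]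
  norm_triangle z w := AlgTensor.norm_le fun S hS => by
    rw [map_add]
    exact (norm_add_le _ _).trans
      (add_le_add (AlgTensor.le_norm S hS z) (AlgTensor.le_norm S hS w))

noncomputable instance : SeminormedAddCommGroup (AlgTensor 𝕜 X Y) :=
  SeminormedAddCommGroup.ofCore AlgTensor.core

noncomputable instance : NormedSpace 𝕜 (AlgTensor 𝕜 X Y) where
  norm_smul_le c z := (AlgTensor.core.norm_smul c z).le

end Tensor

/-- The projective tensor product of `X` and `Y`: the (Hausdorff) completion of `X ⊗ Y` for the
projective norm. -/
abbrev ProjTensor (𝕜 X Y : Type*) [RCLike 𝕜] [NormedAddCommGroup X] [NormedSpace 𝕜 X]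
    [NormedAddCommGroup Y] [NormedSpace 𝕜 Y] : Type _ :=
  UniformSpace.Completion (AlgTensor 𝕜 X Y)

section Decomposition

variable {𝕜 X I : Type*} [RCLike 𝕜] [NormedAddCommGroup X] [NormedSpace 𝕜 X]

/-- `(E i)` is an unconditional Schauder decomposition of `X`: the `E i` are closed subspaces and
every `x` is, in a unique way, the sum of an unconditionally convergent series `∑ i, f i` with
`f i ∈ E i`. -/
structure IsUnconditionalSchauderDecomposition (E : I → Submodule 𝕜 X) : Prop where
  isClosed : ∀ i, IsClosed (E i : Set X)
  existsUnique : ∀ x : X, ∃! f : (i : I) → E i, HasSum (fun i => (f i : X)) x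

namespace IsUnconditionalSchauderDecomposition

variable {E : I → Submodule 𝕜 X} (h : IsUnconditionalSchauderDecomposition E)

/-- The components of `x`. -/
noncomputable def component (x : X) : (i : I) → E i := (h.existsUnique x).choose

theorem hasSum_component (x : X) : HasSum (fun i => (h.component x i : X)) x :=
  (h.existsUnique x).choose_spec.1

theorem component_unique {x : X} {f : (i : I) → E i} (hf : HasSum (fun i => (f i : X)) x) :
    h.component x = f :=
  ((h.existsUnique x).choose_spec.2 f hf).symm

/-- The projection `P i` of `X` onto `E i`. -/
noncomputable def proj (i : I) : X →ₗ[𝕜] X where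
  toFun x := h.component x i
  map_add' x y := by
    have := h.component_unique (x := x + y) (f := fun i => h.component x i + h.component y i)
      (by simpa using (h.hasSum_component x).add (h.hasSum_component y))
    simp [this]
  map_smul' c x := by
    have := h.component_unique (x := c • x) (f := fun i => c • h.component x i)
      (by simpa using (h.hasSum_component x).const_smul c)
    simp [this]

/-- The projection `P_C = ∑ i ∈ C, P i` for a finite set `C` of indices. -/
noncomputable def projFinset (C : Finset I) : X →ₗ[𝕜] X := ∑ i ∈ C, h.proj i

/-- The decomposition has a disjoint lower `p`-estimate. -/
def HasDisjointLowerEstimate (p : ℝ) : Prop :=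
  ∃ c : ℝ, 0 < c ∧ ∀ (r : ℕ) (C : Fin r → Finset I), Pairwise (fun k l => Disjoint (C k) (C l)) →
    ∀ x : X, (∑ k, ‖h.projFinset (C k) x‖ ^ p) ^ (1 / p) ≤ c * ‖x‖

end IsUnconditionalSchauderDecomposition

end Decomposition

/-- `Z` contains a (closed) subspace isomorphic to the sequence space `ℓ¹`. -/
def ContainsEllOne (𝕜 Z : Type*) [RCLike 𝕜] [NormedAddCommGroup Z] [NormedSpace 𝕜 Z] : Prop :=
  ∃ W : Submodule 𝕜 Z, IsClosed (W : Set Z) ∧ Nonempty (W ≃L[𝕜] lp (fun _ : ℕ => 𝕜) 1)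

end PTen

/-! A gliding hump gives unit vectors `u k` in `U` and `v k` in `V`, each within `ε` of its
projection to a block `C k` or `D k`, with the blocks pairwise disjoint
(`exists_almost_disjoint_seq`). The tensors `u k ⊗ v k` then behave like the unit vector basis of
`ℓ¹`. The lower estimate is tested on diagonal forms `∑ s n • φ n ⊗ ψ n` with `‖s n‖ = 1`, where `φ
n`, `ψ n` factor through the block projections and norm the blocks of `u n`, `v n`. Hölder's
inequality and the two lower estimates bound these forms by `K = c * c'`, whatever the phases and
the length (`sum_norm_mul_norm_projFinset_le`). At `(u k, v k)` the diagonal term is at least `1 /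
4`. The other terms see only the remainders off the blocks, both of norm at most `ε`, so the same
bound makes them at most `K * ε * ε` in total. `AlgTensor.lower_estimate` combines these facts. -/

namespace PTen

/-! ### Hölder's inequality beyond conjugate exponents. -/

section Holder

/-- The `ℓ^s` norm is dominated by the `ℓ^q` norm for `q ≤ s`. -/
theorem sum_rpow_rpow_le_of_exponent_le {ι : Type*} (t : Finset ι) (b : ι → ℝ) (hb : ∀ i, 0 ≤ b i)
    {q s : ℝ} (hq : 0 < q) (hqs : q ≤ s) :
    (∑ i ∈ t, b i ^ s) ^ (1 / s) ≤ (∑ i ∈ t, b i ^ q) ^ (1 / q) := by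
  have hs : 0 < s := hq.trans_le hqs
  set S := ∑ i ∈ t, b i ^ q with hSdef
  have hS : 0 ≤ S := Finset.sum_nonneg fun i _ => Real.rpow_nonneg (hb i) q
  have hbS : ∀ i ∈ t, b i ≤ S ^ (1 / q) := fun i hi => by
    rw [one_div, Real.le_rpow_inv_iff_of_pos (hb i) hS hq]
    exact Finset.single_le_sum (f := fun i => b i ^ q)
      (fun j _ => Real.rpow_nonneg (hb j) q) hi
  -- Keep the factor `b i ^ q` for summation and bound the remaining power by the whole `ℓ^q` norm.
  have hterm : ∀ i ∈ t, b i ^ s ≤ b i ^ q * (S ^ (1 / q)) ^ (s - q) := fun i hi => by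
    rw [show b i ^ s = b i ^ q * b i ^ (s - q) by
      rw [← Real.rpow_add_of_nonneg (hb i) hq.le (sub_nonneg.2 hqs)]; ring_nf]
    exact mul_le_mul_of_nonneg_left
      (Real.rpow_le_rpow (hb i) (hbS i hi) (sub_nonneg.2 hqs)) (Real.rpow_nonneg (hb i) q)
  have hsum : ∑ i ∈ t, b i ^ s ≤ S ^ (s / q) := by
    refine (Finset.sum_le_sum hterm).trans_eq ?_
    rw [← Finset.sum_mul, ← hSdef, ← Real.rpow_mul hS]
    nth_rewrite 1 [← Real.rpow_one S]
    rw [← Real.rpow_add_of_nonneg hS zero_le_one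
      (mul_nonneg (by positivity) (sub_nonneg.2 hqs))]
    congr 1
    field_simp
    ring
  calc (∑ i ∈ t, b i ^ s) ^ (1 / s) ≤ (S ^ (s / q)) ^ (1 / s) :=
        Real.rpow_le_rpow (Finset.sum_nonneg fun i _ => Real.rpow_nonneg (hb i) s) hsum
          (by positivity)
    _ = S ^ (1 / q) := by
        rw [← Real.rpow_mul hS]
        congr 1
        field_simp

/-- Hölder's inequality for finite sums and exponents with `1 ≤ 1 / p + 1 / q`. -/
theorem sum_mul_le_of_one_le_inv_add_inv {ι : Type*} (t : Finset ι) (a b : ι → ℝ)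
    (ha : ∀ i, 0 ≤ a i) (hb : ∀ i, 0 ≤ b i) {p q : ℝ} (hp : 1 < p) (hq : 0 < q)
    (hpq : 1 ≤ 1 / p + 1 / q) :
    ∑ i ∈ t, a i * b i ≤ (∑ i ∈ t, a i ^ p) ^ (1 / p) * (∑ i ∈ t, b i ^ q) ^ (1 / q) := by
  have hc := Real.HolderConjugate.conjExponent hp
  -- The condition `1 ≤ 1 / p + 1 / q` says exactly this.
  have hle : q ≤ p.conjExponent := by
    have h1 := hc.inv_add_inv_eq_one
    rw [one_div, one_div] at hpq
    exact (inv_le_inv₀ hc.symm.pos hq).1 (by linarith)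
  refine (Real.inner_le_Lp_mul_Lq_of_nonneg t hc (fun i _ => ha i) fun i _ => hb i).trans ?_
  exact mul_le_mul_of_nonneg_left (sum_rpow_rpow_le_of_exponent_le t b hb hq hle)
    (Real.rpow_nonneg (Finset.sum_nonneg fun i _ => Real.rpow_nonneg (ha i) p) _)

end Holder

/-! ### Recognising copies of `ℓ¹`. -/

section EllOne

variable {𝕜 Z : Type*} [RCLike 𝕜] [NormedAddCommGroup Z] [NormedSpace 𝕜 Z] [CompleteSpace Z]

theorem summable_norm_ellOne (a : lp (fun _ : ℕ => 𝕜) 1) : Summable fun k => ‖a k‖ := by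
  simpa using (lp.memℓp a).summable (by simp)

theorem norm_ellOne (a : lp (fun _ : ℕ => 𝕜) 1) : ‖a‖ = ∑' k, ‖a k‖ := by
  simpa using lp.norm_eq_tsum_rpow (p := 1) (by simp) a

/-- A bounded sequence with a lower `ℓ¹`-estimate spans a copy of `ℓ¹`. -/
theorem containsEllOne_of_lower_estimate (z : ℕ → Z) (hz : ∀ k, ‖z k‖ ≤ 1) {δ : ℝ} (hδ : 0 < δ)
    (h : ∀ (a : ℕ → 𝕜) (N : ℕ),
      δ * ∑ k ∈ Finset.range N, ‖a k‖ ≤ ‖∑ k ∈ Finset.range N, a k • z k‖) :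
    ContainsEllOne 𝕜 Z := by
  have hle : ∀ (a : lp (fun _ : ℕ => 𝕜) 1) (k : ℕ), ‖a k • z k‖ ≤ ‖a k‖ := fun a k => by
    rw [norm_smul]
    exact mul_le_of_le_one_right (norm_nonneg _) (hz k)
  have hs : ∀ a : lp (fun _ : ℕ => 𝕜) 1, Summable fun k => a k • z k := fun a =>
    Summable.of_norm_bounded (summable_norm_ellOne a) (hle a)
  let T₀ : lp (fun _ : ℕ => 𝕜) 1 →ₗ[𝕜] Z :=
    { toFun := fun a => ∑' k, a k • z k
      map_add' := fun a b => by
        rw [← (hs a).tsum_add (hs b)]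
        simp [add_smul]
      map_smul' := fun c a => by
        rw [RingHom.id_apply, ← (hs a).tsum_const_smul c]
        simp [mul_smul] }
  let T : lp (fun _ : ℕ => 𝕜) 1 →L[𝕜] Z := T₀.mkContinuous 1 fun a => by
    rw [one_mul, norm_ellOne]
    exact tsum_of_norm_bounded (summable_norm_ellOne a).hasSum (hle a)
  have hlow : ∀ a, δ * ‖a‖ ≤ ‖T a‖ := fun a => by
    rw [norm_ellOne]
    exact le_of_tendsto_of_tendsto'
      ((summable_norm_ellOne a).hasSum.tendsto_sum_nat.const_mul δ)
      (hs a).hasSum.tendsto_sum_nat.norm fun N => h a N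
  have hT : AntilipschitzWith (Real.toNNReal δ⁻¹) T := by
    refine AddMonoidHomClass.antilipschitz_of_bound T fun a => ?_
    rw [Real.coe_toNNReal _ (inv_nonneg.2 hδ.le), inv_mul_eq_div, le_div_iff₀' hδ]
    exact hlow a
  -- The range is closed because `T` is bounded below on the complete space `ℓ¹`.
  have hcl : IsClosed (Set.range T) := hT.isClosed_range T.uniformContinuous
  exact ⟨T.range, by rw [LinearMap.coe_range]; exact hcl,
    ⟨(T.equivRange hT.injective hcl).symm⟩⟩

end EllOne

/-! ### Block projections and the gliding hump. -/

namespace IsUnconditionalSchauderDecomposition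

variable {𝕜 X I : Type*} [RCLike 𝕜] [NormedAddCommGroup X] [NormedSpace 𝕜 X]
  {E : I → Submodule 𝕜 X} (h : IsUnconditionalSchauderDecomposition E)

theorem proj_mem (i : I) (x : X) : h.proj i x ∈ E i := (h.component x i).2

theorem hasSum_proj (x : X) : HasSum (fun i => h.proj i x) x := h.hasSum_component x

theorem projFinset_apply (C : Finset I) (x : X) : h.projFinset C x = ∑ i ∈ C, h.proj i x := by
  simp [projFinset]

/-- By uniqueness, a vector of `E j` has only its one-term expansion. -/
theorem proj_proj_of_ne {i j : I} (hij : i ≠ j) (x : X) : h.proj i (h.proj j x) = 0 := by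
  classical
  have hf : HasSum (fun l => ((Pi.single j (h.component x j) : (l : I) → E l) l : X))
      (h.proj j x) := by
    convert hasSum_single (f := fun l => ((Pi.single j (h.component x j) : (l : I) → E l) l : X))
      j fun l hl => by simp [hl] using 1
    simp [proj]
  have := h.component_unique hf
  change ((h.component (h.proj j x) i : E i) : X) = 0
  rw [this]
  simp [hij]

theorem projFinset_projFinset_of_disjoint {C D : Finset I} (hCD : Disjoint C D) (x : X) :
    h.projFinset C (h.projFinset D x) = 0 := by
  rw [projFinset_apply, projFinset_apply]
  refine Finset.sum_eq_zero fun i hi => ?_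
  rw [map_sum]
  exact Finset.sum_eq_zero fun j hj =>
    h.proj_proj_of_ne (by rintro rfl; exact Finset.disjoint_left.1 hCD hi hj) x

/-- The case `r = 1` of the lower estimate; it supplies the continuity of the block projections. -/
theorem norm_projFinset_le_of_lower_estimate {p c : ℝ} (hp : 0 < p)
    (hc : ∀ (r : ℕ) (C : Fin r → Finset I), Pairwise (fun k l => Disjoint (C k) (C l)) →
      ∀ x : X, (∑ k, ‖h.projFinset (C k) x‖ ^ p) ^ (1 / p) ≤ c * ‖x‖) (C : Finset I) (x : X) :
    ‖h.projFinset C x‖ ≤ c * ‖x‖ := by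
  have := hc 1 (fun _ => C) (fun k l hkl => absurd (Subsingleton.elim k l) hkl) x
  rwa [Fin.sum_univ_one, ← Real.rpow_mul (norm_nonneg _), mul_one_div_cancel hp.ne',
    Real.rpow_one] at this

/-- In an infinite-dimensional subspace one finds a unit vector with prescribed finite set of
vanishing components. -/
theorem exists_norm_eq_one_proj_eq_zero (hE : ∀ i, FiniteDimensional 𝕜 (E i)) (U : Submodule 𝕜 X)
    (hU : ¬ FiniteDimensional 𝕜 U) (A : Finset I) :
    ∃ u ∈ U, ‖u‖ = 1 ∧ ∀ i ∈ A, h.proj i u = 0 := by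
  let L : U →ₗ[𝕜] ((i : A) → E i) := LinearMap.pi fun i =>
    ((h.proj i).codRestrict (E i) (h.proj_mem i)).comp U.subtype
  have hL : ¬ Function.Injective L := fun hinj => hU (FiniteDimensional.of_injective L hinj)
  rw [← LinearMap.ker_eq_bot, Submodule.eq_bot_iff] at hL
  push Not at hL
  obtain ⟨u, hu, hu0⟩ := hL
  have hu0' : (u : X) ≠ 0 := fun h0 => hu0 (Subtype.ext h0)
  refine ⟨((‖(u : X)‖⁻¹ : ℝ) : 𝕜) • (u : X), U.smul_mem _ u.2, ?_, fun i hi => ?_⟩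
  · rw [norm_smul]
    simp [hu0']
  · have := congrArg Subtype.val (congrFun (LinearMap.mem_ker.1 hu) ⟨i, hi⟩)
    have h0 : h.proj i (u : X) = 0 := this
    rw [map_smul, h0, smul_zero]

/-- An infinite-dimensional subspace contains almost disjointly supported unit vectors. -/
theorem exists_almost_disjoint_seq (hE : ∀ i, FiniteDimensional 𝕜 (E i)) (U : Submodule 𝕜 X)
    (hU : ¬ FiniteDimensional 𝕜 U) {ε : ℝ} (hε : 0 < ε) :
    ∃ (u : ℕ → U) (C : ℕ → Finset I), (∀ k, ‖u k‖ = 1) ∧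
      (∀ k, ‖(u k : X) - h.projFinset (C k) (u k : X)‖ ≤ ε) ∧
      Pairwise fun k l => Disjoint (C k) (C l) := by
  classical
  have : Std.Symm fun a b : U × Finset I => Disjoint a.2 b.2 := ⟨fun _ _ hab => hab.symm⟩
  obtain ⟨f, hf, hd⟩ := exists_seq_of_forall_finset_exists'
    (fun a : U × Finset I => ‖a.1‖ = 1 ∧ ‖(a.1 : X) - h.projFinset a.2 (a.1 : X)‖ ≤ ε)
    (fun a b => Disjoint a.2 b.2) (fun s _ => by
      obtain ⟨u, huU, hu1, hu0⟩ :=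
        h.exists_norm_eq_one_proj_eq_zero hE U hU (s.biUnion Prod.snd)
      obtain ⟨C, hC⟩ := ((Metric.tendsto_nhds.1 (h.hasSum_proj u)) ε hε).exists
      -- Since `u` has no components on the indices already used, deleting them from `C` does not
      -- change the partial sum.
      refine ⟨(⟨u, huU⟩, C \ s.biUnion Prod.snd), ⟨hu1, ?_⟩, fun a ha => ?_⟩
      · have hsum : h.projFinset (C \ s.biUnion Prod.snd) u = ∑ i ∈ C, h.proj i u := by
          rw [projFinset_apply]
          refine Finset.sum_subset Finset.sdiff_subset fun i hi hi' => hu0 i ?_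
          by_contra hi''
          exact hi' (Finset.mem_sdiff.2 ⟨hi, hi''⟩)
        change ‖u - h.projFinset (C \ s.biUnion Prod.snd) u‖ ≤ ε
        rw [hsum, ← dist_eq_norm, dist_comm]
        exact hC.le
      · exact Finset.disjoint_of_subset_left (Finset.subset_biUnion_of_mem Prod.snd ha)
          Finset.disjoint_sdiff)
  exact ⟨fun k => (f k).1, fun k => (f k).2, fun k => (hf k).1, fun k => (hf k).2, hd⟩

/-- A norming functional for `P_C u` composed with `P_C`. -/
theorem exists_functional_projFinset {c : ℝ}
    (hc : ∀ (C : Finset I) (x : X), ‖h.projFinset C x‖ ≤ c * ‖x‖) (C : Finset I) (u : X) :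
    ∃ φ : X →L[𝕜] 𝕜, (∀ x, ‖φ x‖ ≤ ‖h.projFinset C x‖) ∧ φ u = (‖h.projFinset C u‖ : 𝕜) := by
  -- Asking only for `‖g‖ ≤ 1` also covers a vanishing block.
  obtain ⟨g, hg1, hg⟩ := exists_dual_vector'' 𝕜 (h.projFinset C u)
  refine ⟨g.comp ((h.projFinset C).mkContinuous c (hc C)), fun x => ?_, hg⟩
  exact (g.le_opNorm _).trans (mul_le_of_le_one_left (norm_nonneg _) hg1)

end IsUnconditionalSchauderDecomposition

end PTen

namespace PTen

/-! ### Estimates in the projective norm. -/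

section Tensor

variable {𝕜 U V : Type*} [RCLike 𝕜] [NormedAddCommGroup U] [NormedSpace 𝕜 U]
  [NormedAddCommGroup V] [NormedSpace 𝕜 V]

theorem AlgTensor.norm_tmul_le (x : U) (y : V) : ‖AlgTensor.tmul 𝕜 x y‖ ≤ ‖x‖ * ‖y‖ :=
  AlgTensor.norm_le fun S hS => by
    rw [AlgTensor.functional_tmul]
    refine (S.le_opNorm₂ x y).trans ?_
    rw [mul_assoc]
    exact mul_le_of_le_one_left (by positivity) hS

/-- Rescaling by `K⁻¹` puts `S` in the unit ball over which the norm is a supremum. -/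
theorem AlgTensor.norm_functional_le {K : ℝ} (hK : 0 < K) (S : U →L[𝕜] V →L[𝕜] 𝕜) (hS : ‖S‖ ≤ K)
    (z : AlgTensor 𝕜 U V) : ‖AlgTensor.functional S z‖ ≤ K * ‖z‖ := by
  have hn : ‖((K⁻¹ : ℝ) : 𝕜)‖ = K⁻¹ := by simp [abs_of_pos hK]
  have h1 : ‖((K⁻¹ : ℝ) : 𝕜) • S‖ ≤ 1 := by
    refine ContinuousLinearMap.opNorm_le_bound₂ _ zero_le_one fun x y => ?_
    change ‖((K⁻¹ : ℝ) : 𝕜) • S x y‖ ≤ _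
    rw [norm_smul, hn, inv_mul_le_iff₀ hK, one_mul, ← mul_assoc]
    exact S.le_of_opNorm₂_le_of_le hS le_rfl le_rfl
  have h2 : AlgTensor.functional (((K⁻¹ : ℝ) : 𝕜) • S) z
      = ((K⁻¹ : ℝ) : 𝕜) • AlgTensor.functional S z := by
    have : AlgTensor.functional (((K⁻¹ : ℝ) : 𝕜) • S)
        = ((K⁻¹ : ℝ) : 𝕜) • (AlgTensor.functional S : AlgTensor 𝕜 U V →ₗ[𝕜] 𝕜) :=
      TensorProduct.ext' fun x y => by
        change AlgTensor.functional (((K⁻¹ : ℝ) : 𝕜) • S) (AlgTensor.tmul 𝕜 x y)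
          = ((K⁻¹ : ℝ) : 𝕜) • AlgTensor.functional S (AlgTensor.tmul 𝕜 x y)
        rw [AlgTensor.functional_tmul, AlgTensor.functional_tmul]
        rfl
    rw [this]
    rfl
  have h3 := AlgTensor.le_norm _ h1 z
  rwa [h2, norm_smul, hn, inv_mul_le_iff₀ hK] at h3

/-- Lower `ℓ¹`-estimate for `u k ⊗ v k` from almost biorthogonal functionals whose diagonal
bilinear forms are uniformly bounded. -/
theorem AlgTensor.lower_estimate (u : ℕ → U) (v : ℕ → V) (φ : ℕ → U →L[𝕜] 𝕜) (ψ : ℕ → V →L[𝕜] 𝕜)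
    {K α β : ℝ} (hK : 0 < K) (d : ℕ → ℝ) (hd : ∀ k, α ≤ d k)
    (hdiag : ∀ k, φ k (u k) * ψ k (v k) = (d k : 𝕜))
    (hbound : ∀ N x y, ∑ n ∈ Finset.range N, ‖φ n x‖ * ‖ψ n y‖ ≤ K * ‖x‖ * ‖y‖)
    (hoff : ∀ N k, ∑ n ∈ (Finset.range N).erase k, ‖φ n (u k)‖ * ‖ψ n (v k)‖ ≤ β)
    (a : ℕ → 𝕜) (N : ℕ) :
    (α - β) / K * ∑ k ∈ Finset.range N, ‖a k‖
      ≤ ‖∑ k ∈ Finset.range N, a k • AlgTensor.tmul 𝕜 (u k) (v k)‖ := by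
  -- The phases turn each diagonal contribution `a k * s k` into `‖a k‖`, so no cancellation occurs.
  choose s hs1 hs using fun k => RCLike.exists_norm_eq_mul_self (a k)
  let S : U →L[𝕜] V →L[𝕜] 𝕜 := ∑ n ∈ Finset.range N, (φ n).smulRight (s n • ψ n)
  have hSapp : ∀ x y, S x y = ∑ n ∈ Finset.range N, s n * (φ n x * ψ n y) := fun x y => by
    simp only [S, sum_apply, ContinuousLinearMap.smulRight_apply,
      smul_apply, smul_eq_mul]
    exact Finset.sum_congr rfl fun n _ => by ring
  have hterm : ∀ n x y, ‖s n * (φ n x * ψ n y)‖ = ‖φ n x‖ * ‖ψ n y‖ := fun n x y => by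
    rw [norm_mul, norm_mul, hs1, one_mul]
  have hSnorm : ‖S‖ ≤ K := S.opNorm_le_bound₂ hK.le fun x y => by
    rw [hSapp]
    refine (norm_sum_le _ _).trans ?_
    simp only [hterm]
    exact hbound N x y
  have hval : ∀ k ∈ Finset.range N, ‖a k * S (u k) (v k) - ((‖a k‖ * d k : ℝ) : 𝕜)‖
      ≤ ‖a k‖ * β := fun k hk => by
    -- The diagonal term is exactly `‖a k‖ * d k`, so only indices `n ≠ k` enter the error.
    have : a k * S (u k) (v k) - ((‖a k‖ * d k : ℝ) : 𝕜)
        = a k * ∑ n ∈ (Finset.range N).erase k, s n * (φ n (u k) * ψ n (v k)) := by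
      rw [hSapp, ← Finset.add_sum_erase _ _ hk, hdiag]
      rw [RCLike.ofReal_mul, hs k]
      ring
    rw [this, norm_mul]
    refine mul_le_mul_of_nonneg_left ((norm_sum_le _ _).trans ?_) (norm_nonneg _)
    simp only [hterm]
    exact hoff N k
  set z := ∑ k ∈ Finset.range N, a k • AlgTensor.tmul 𝕜 (u k) (v k)
  have hz : AlgTensor.functional S z = ∑ k ∈ Finset.range N, a k * S (u k) (v k) := by
    simp only [z, map_sum, map_smul, AlgTensor.functional_tmul, smul_eq_mul]
  have herr : ‖AlgTensor.functional S z - ((∑ k ∈ Finset.range N, ‖a k‖ * d k : ℝ) : 𝕜)‖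
      ≤ (∑ k ∈ Finset.range N, ‖a k‖) * β := by
    rw [hz, RCLike.ofReal_sum, ← Finset.sum_sub_distrib, Finset.sum_mul]
    exact (norm_sum_le _ _).trans (Finset.sum_le_sum hval)
  have hmain : (∑ k ∈ Finset.range N, ‖a k‖) * α ≤ ∑ k ∈ Finset.range N, ‖a k‖ * d k := by
    rw [Finset.sum_mul]
    exact Finset.sum_le_sum fun k _ => mul_le_mul_of_nonneg_left (hd k) (norm_nonneg _)
  have hsz := AlgTensor.norm_functional_le hK S hSnorm z
  have htri := norm_sub_norm_le ((∑ k ∈ Finset.range N, ‖a k‖ * d k : ℝ) : 𝕜)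
    (AlgTensor.functional S z)
  rw [norm_sub_rev, RCLike.norm_ofReal] at htri
  have habs := le_abs_self (∑ k ∈ Finset.range N, ‖a k‖ * d k)
  rw [div_mul_eq_mul_div, div_le_iff₀ hK]
  linarith

end Tensor

/-! ### Uniform bound for diagonal forms. -/

namespace IsUnconditionalSchauderDecomposition

variable {𝕜 X Y I J : Type*} [RCLike 𝕜] [NormedAddCommGroup X] [NormedSpace 𝕜 X]
  [NormedAddCommGroup Y] [NormedSpace 𝕜 Y] {E : I → Submodule 𝕜 X} {F : J → Submodule 𝕜 Y}
  (hE : IsUnconditionalSchauderDecomposition E) (hF : IsUnconditionalSchauderDecomposition F)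

/-- The bound does not depend on `N`. It serves twice: for the norm of the diagonal forms and,
applied to remainders, for the off-diagonal error. -/
theorem sum_norm_mul_norm_projFinset_le {p q c c' : ℝ} (hp : 1 < p) (hq : 1 < q)
    (hpq : 1 ≤ 1 / p + 1 / q)
    (hc : ∀ (r : ℕ) (C : Fin r → Finset I), Pairwise (fun k l => Disjoint (C k) (C l)) →
      ∀ x : X, (∑ k, ‖hE.projFinset (C k) x‖ ^ p) ^ (1 / p) ≤ c * ‖x‖)
    (hc' : ∀ (r : ℕ) (D : Fin r → Finset J), Pairwise (fun k l => Disjoint (D k) (D l)) →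
      ∀ y : Y, (∑ k, ‖hF.projFinset (D k) y‖ ^ q) ^ (1 / q) ≤ c' * ‖y‖)
    {C : ℕ → Finset I} (hC : Pairwise fun k l => Disjoint (C k) (C l))
    {D : ℕ → Finset J} (hD : Pairwise fun k l => Disjoint (D k) (D l)) (N : ℕ) (x : X) (y : Y) :
    ∑ n ∈ Finset.range N, ‖hE.projFinset (C n) x‖ * ‖hF.projFinset (D n) y‖
      ≤ (c * ‖x‖) * (c' * ‖y‖) := by
  rw [Finset.sum_range]
  have h1 := hc N (fun k => C k) (fun k l hkl => hC (Fin.val_injective.ne hkl)) x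
  have h2 := hc' N (fun k => D k) (fun k l hkl => hD (Fin.val_injective.ne hkl)) y
  refine (sum_mul_le_of_one_le_inv_add_inv Finset.univ
    (fun n : Fin N => ‖hE.projFinset (C n) x‖) (fun n : Fin N => ‖hF.projFinset (D n) y‖)
    (fun _ => norm_nonneg _) (fun _ => norm_nonneg _) hp (zero_lt_one.trans hq) hpq).trans ?_
  exact mul_le_mul h1 h2
    (Real.rpow_nonneg (Finset.sum_nonneg fun _ _ => Real.rpow_nonneg (norm_nonneg _) _) _)
    ((Real.rpow_nonneg (Finset.sum_nonneg fun _ _ => Real.rpow_nonneg (norm_nonneg _) _) _).trans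
      h1)

end IsUnconditionalSchauderDecomposition

end PTen

theorem corollary3p17 {𝕜 X Y I J : Type*} [RCLike 𝕜]
    [NormedAddCommGroup X] [NormedSpace 𝕜 X] [CompleteSpace X]
    [NormedAddCommGroup Y] [NormedSpace 𝕜 Y] [CompleteSpace Y]
    (E : I → Submodule 𝕜 X) (F : J → Submodule 𝕜 Y)
    (hE : PTen.IsUnconditionalSchauderDecomposition E)
    (hF : PTen.IsUnconditionalSchauderDecomposition F)
    (hEfin : ∀ i, FiniteDimensional 𝕜 (E i)) (hFfin : ∀ j, FiniteDimensional 𝕜 (F j))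
    (p q : ℝ) (hp : 1 < p) (hq : 1 < q) (hpq : 1 ≤ 1 / p + 1 / q)
    (hEp : hE.HasDisjointLowerEstimate p) (hFq : hF.HasDisjointLowerEstimate q)
    (U : Submodule 𝕜 X) (hU : IsClosed (U : Set X)) (hUinf : ¬ FiniteDimensional 𝕜 U)
    (V : Submodule 𝕜 Y) (hV : IsClosed (V : Set Y)) (hVinf : ¬ FiniteDimensional 𝕜 V) :
    PTen.ContainsEllOne 𝕜 (PTen.ProjTensor 𝕜 U V) := by
  obtain ⟨c, hc0, hc⟩ := hEp
  obtain ⟨c', hc'0, hc'⟩ := hFq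
  set K := c * c' with hK
  have hK0 : 0 < K := mul_pos hc0 hc'0
  -- `ε ≤ 1 / 2` makes the diagonal at least `(1 - ε) ^ 2 ≥ 1 / 4`; the second bound keeps the
  -- off-diagonal error at `1 / 8`.
  obtain ⟨ε, hε, hε2, hεK⟩ : ∃ ε : ℝ, 0 < ε ∧ ε ≤ 1 / 2 ∧ K * ε * ε ≤ 1 / 8 := by
    refine ⟨1 / (2 * (1 + K)), by positivity, ?_, ?_⟩
    · exact one_div_le_one_div_of_le two_pos (by linarith)
    · rw [mul_assoc, div_mul_div_comm, ← mul_div_assoc, div_le_div_iff₀ (by positivity) (by norm_num)]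
      nlinarith [sq_nonneg (1 - K)]
  obtain ⟨u, C, hu1, huC, hC⟩ := hE.exists_almost_disjoint_seq hEfin U hUinf hε
  obtain ⟨v, D, hv1, hvD, hD⟩ := hF.exists_almost_disjoint_seq hFfin V hVinf hε
  choose φ hφ hφu using fun k => hE.exists_functional_projFinset
    (hE.norm_projFinset_le_of_lower_estimate (zero_lt_one.trans hp) hc) (C k) (u k : X)
  choose ψ hψ hψv using fun k => hF.exists_functional_projFinset
    (hF.norm_projFinset_le_of_lower_estimate (zero_lt_one.trans hq) hc') (D k) (v k : Y)
  have hsum := hE.sum_norm_mul_norm_projFinset_le hF hp hq hpq hc hc' hC hD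
  refine PTen.containsEllOne_of_lower_estimate (δ := (1 / 4 - 1 / 8) / K)
    (fun k => ((PTen.AlgTensor.tmul 𝕜 (u k) (v k) : PTen.AlgTensor 𝕜 U V) :
      PTen.ProjTensor 𝕜 U V)) (fun k => ?_) (by positivity) fun a N => ?_
  · rw [UniformSpace.Completion.norm_coe]
    refine (PTen.AlgTensor.norm_tmul_le _ _).trans ?_
    rw [hu1, hv1, one_mul]
  · have hcoe : ∑ k ∈ Finset.range N, a k •
        ((PTen.AlgTensor.tmul 𝕜 (u k) (v k) : PTen.AlgTensor 𝕜 U V) : PTen.ProjTensor 𝕜 U V)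
        = ((∑ k ∈ Finset.range N, a k • PTen.AlgTensor.tmul 𝕜 (u k) (v k) :
          PTen.AlgTensor 𝕜 U V) : PTen.ProjTensor 𝕜 U V) := by
      rw [← UniformSpace.Completion.coe_toComplL (𝕜 := 𝕜), map_sum]
      simp only [map_smul]
    rw [hcoe, UniformSpace.Completion.norm_coe]
    refine PTen.AlgTensor.lower_estimate u v (fun k => (φ k).comp U.subtypeL)
      (fun k => (ψ k).comp V.subtypeL) hK0
      (fun k => ‖hE.projFinset (C k) (u k : X)‖ * ‖hF.projFinset (D k) (v k : Y)‖)
      (fun k => ?_) (fun k => ?_) (fun M x y => ?_) (fun M k => ?_) a N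
    · have h1 := (norm_sub_norm_le (u k : X) _).trans (huC k)
      have h2 := (norm_sub_norm_le (v k : Y) _).trans (hvD k)
      rw [Submodule.norm_coe, hu1] at h1
      rw [Submodule.norm_coe, hv1] at h2
      nlinarith
    · change φ k (u k : X) * ψ k (v k : Y) = _
      rw [hφu, hψv]
      push_cast
      rfl
    · refine (Finset.sum_le_sum fun n _ => mul_le_mul (hφ n x) (hψ n y) (norm_nonneg _)
        (norm_nonneg _)).trans ((hsum M x y).trans_eq ?_)
      rw [hK]
      change c * ‖x‖ * (c' * ‖y‖) = c * c' * ‖x‖ * ‖y‖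
      ring
    · set w := (u k : X) - hE.projFinset (C k) (u k : X)
      set w' := (v k : Y) - hF.projFinset (D k) (v k : Y)
      -- The projection to `C n` kills the block part of `u k`, as `C n` and `C k` are disjoint.
      have hw : ∀ n, n ≠ k → hE.projFinset (C n) (u k : X) = hE.projFinset (C n) w :=
        fun n hn => by
          rw [map_sub, hE.projFinset_projFinset_of_disjoint (hC hn), sub_zero]
      have hw' : ∀ n, n ≠ k → hF.projFinset (D n) (v k : Y) = hF.projFinset (D n) w' :=
        fun n hn => by
          rw [map_sub, hF.projFinset_projFinset_of_disjoint (hD hn), sub_zero]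
      calc ∑ n ∈ (Finset.range M).erase k, ‖φ n (u k : X)‖ * ‖ψ n (v k : Y)‖
          ≤ ∑ n ∈ (Finset.range M).erase k,
              ‖hE.projFinset (C n) w‖ * ‖hF.projFinset (D n) w'‖ :=
            Finset.sum_le_sum fun n hn => by
              have hnk := Finset.ne_of_mem_erase hn
              rw [← hw n hnk, ← hw' n hnk]
              exact mul_le_mul (hφ n _) (hψ n _) (norm_nonneg _) (norm_nonneg _)
        -- Restoring the nonnegative term `n = k` allows the uniform bound to be applied to `w` and
        -- `w'`.
        _ ≤ ∑ n ∈ Finset.range M, ‖hE.projFinset (C n) w‖ * ‖hF.projFinset (D n) w'‖ :=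
            Finset.sum_le_sum_of_subset_of_nonneg (Finset.erase_subset _ _)
              fun _ _ _ => by positivity
        _ ≤ c * ‖w‖ * (c' * ‖w'‖) := hsum M w w'
        _ = K * ‖w‖ * ‖w'‖ := by rw [hK]; ring
        _ ≤ K * ε * ε := by
            have := huC k
            have := hvD k
            gcongr
        _ ≤ 1 / 8 := hεK
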